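/- Let $\lambda_1,\dots,\lambda_N$ be distinct real numbers with $\lambda_\alpha\neq\pm1$, and let $\Lambda=\mathrm{diag}(\lambda_1,\dots,\lambda_N)$. Let $\mathbf R^{4N}=\mathbf C^{2N}$ have complex coordinates $\phi_{j\alpha}$ $(j=1,2;\ \alpha=1,\dots,N)$, put $\Phi_j=(\phi_{j1},\dots,\phi_{jN})^T$, $\langle V_1,V_2\rangle=V_1^*V_2$, and use the Poisson bracket $$\{f,g\}=\frac1{\mathrm i}\sum_{j=1}^2\sum_{\alpha=1}^N\left(\frac{\partial f}{\partial\phi_{j\alpha}}\frac{\partial g}{\partial\bar\phi_{j\alpha}}-\frac{\partial g}{\partial\phi_{j\alpha}}\frac{\partial f}{\partial\bar\phi_{j\alpha}}\right).$$ Consider the Hamiltonians $$H^x=-\frac12\sum_{j,k=1}^2\langle\Phi_k,(1-\Lambda)^{-1}\Phi_j\rangle\langle\Phi_j,(1-\Lambda)^{-1}\Phi_k\rangle,\qquad H^t=-\frac12\sum_{j,k=1}^2\langle\Phi_k,(1+\Lambda)^{-1}\Phi_j\rangle\langle\Phi_j,(1+\Lambda)^{-1}\Phi_k\rangle$$ and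 the corresponding Hamiltonian systems $\mathrm i\,\phi_{j\alpha,x}=\partial H^x/\partial\bar\phi_{j\alpha}$ and $\mathrm i\,\phi_{j\alpha,t}=\partial H^t/\partial\bar\phi_{j\alpha}$ (together with their complex conjugates). **Theorem.** (1) Both Hamiltonian systems are completely integrable in the Liouville sense, with common integrals: there are $2N$ real-valued real-analytic functions $F_1,\dots,F_{2N}$ on $\mathbf R^{4N}$ with $\{F_i,H^x\}=\{F_i,H^t\}=0$ and $\{F_i,F_k\}=0$ for all $i,k$, whose differentials are linearly independent at every point of a dense open subset of $\mathbf R^{4N}$. (2) Let $\phi=\phi(x,t)$ be a $C^1$ solution of both Hamiltonian systems on an open set $U\subset\mathbf R^2$, and let $P,Q$ be the $2\times2$ matrix functions on $U$ given by $$P_{jk}=\mathrm i\langle\Phi_k,(1-\Lambda)^{-1}\Phi_j\rangle,\qquad Q_{jk}=\mathrm i\langle\Phi_k,(1+\Lambda)^{-1}\Phi_j\rangle.$$ Then $(P,Q)$ is a $C^1$ solution on $U$ of the $U(2)$ principal chiral field equations: $P$ and $Q$ take values in $u(2)$ (that is, $P^*+P=0$ and $Q^*+Q=0$) and $$P_t+Q_x=0,\qquad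 P_t-Q_x+[P,Q]=0 .$$ Moreover $\left(P-\tfrac12(\mathrm{tr}P)I,\ Q-\tfrac12(\mathrm{tr}Q)I\right)$ is a $C^1$ solution of the same equations with values in $su(2)$ (skew-Hermitian matrices of trace $0$), i.e. a solution of the $SU(2)$ principal chiral field. -/

import Mathlib

open scoped ContDiff

namespace ChiralField

/-- The phase space `ℝ^{2nN} = ℂ^{nN}` of points `φ = (φ_{jα})`, `1 ≤ j ≤ n`, `1 ≤ α ≤ N`, regarded
as a real vector space; `φ j` is the vector `Φ_j = (φ_{j1}, …, φ_{jN})`. -/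
abbrev Phase (n N : ℕ) : Type := Fin n → Fin N → ℂ

/-! ### The standard symplectic structure on the phase space -/

/-- The phase space vector whose `(j, α)` coordinate is `c` and whose other coordinates are `0`. -/
noncomputable def coordVec {n N : ℕ} (j : Fin n) (α : Fin N) (c : ℂ) : Phase n N :=
  Pi.single j (Pi.single α c)

/-- The Wirtinger derivative `∂f/∂φ_{jα} = ½ (∂f/∂Re φ_{jα} - i ∂f/∂Im φ_{jα})`. -/
noncomputable def dPhi {n N : ℕ} (f : Phase n N → ℝ) (j : Fin n) (α : Fin N) (p : Phase n N) : ℂ :=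
  (1 / 2 : ℂ) * ((fderiv ℝ f p (coordVec j α 1) : ℂ)
    - Complex.I * (fderiv ℝ f p (coordVec j α Complex.I) : ℂ))

/-- The Wirtinger derivative `∂f/∂φ̄_{jα} = ½ (∂f/∂Re φ_{jα} + i ∂f/∂Im φ_{jα})`. -/
noncomputable def dPhiBar {n N : ℕ} (f : Phase n N → ℝ) (j : Fin n) (α : Fin N) (p : Phase n N) :
    ℂ :=
  (1 / 2 : ℂ) * ((fderiv ℝ f p (coordVec j α 1) : ℂ)
    + Complex.I * (fderiv ℝ f p (coordVec j α Complex.I) : ℂ))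

/-- The Poisson bracket
`{f, g} = (1/i) ∑_{j,α} (∂f/∂φ_{jα} ∂g/∂φ̄_{jα} - ∂g/∂φ_{jα} ∂f/∂φ̄_{jα})`
of the symplectic form `2 ∑_{j,α} d(Im φ_{jα}) ∧ d(Re φ_{jα})`. -/
noncomputable def poisson {n N : ℕ} (f g : Phase n N → ℝ) (p : Phase n N) : ℂ :=
  (1 / Complex.I) * ∑ j : Fin n, ∑ α : Fin N,
    (dPhi f j α p * dPhiBar g j α p - dPhi g j α p * dPhiBar f j α p)

/-- `F` is a full set of integrals in the sense of Liouville for the Hamiltonian system with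
Hamiltonian `H` on the phase space of real dimension `2nN`: the `F i` are `nN` real-analytic
functions, they are conserved (they Poisson commute with `H`), they are in involution, and they are
functionally independent (their differentials are linearly independent) on a dense open set. -/
structure IsLiouvilleIntegrals {n N : ℕ} (H : Phase n N → ℝ) (F : Fin (n * N) → Phase n N → ℝ) :
    Prop where
  analytic : ∀ i, ContDiff ℝ ω (F i)
  conserved : ∀ i p, poisson (F i) H p = 0
  involution : ∀ i k p, poisson (F i) (F k) p = 0
  independent : ∃ V : Set (Phase n N), IsOpen V ∧ Dense V ∧
    ∀ p ∈ V, LinearIndependent ℝ fun i => fderiv ℝ (F i) p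

/-! ### The Hamiltonians and the constraint -/

/-- `⟨u, D v⟩ = u^* D v`, where `D` is the real diagonal matrix with diagonal entries `w`. -/
noncomputable def pairing {N : ℕ} (w : Fin N → ℝ) (u v : Fin N → ℂ) : ℂ :=
  ∑ α, starRingEnd ℂ (u α) * ((w α : ℂ) * v α)

/-- The real function `-½ ∑_{j,k} ⟨Φ_k, D Φ_j⟩ ⟨Φ_j, D Φ_k⟩` with `D = diag(w)`; the double sum is
real, see `hamiltonian_eq`. -/
noncomputable def hamiltonian {n N : ℕ} (w : Fin N → ℝ) (p : Phase n N) : ℝ :=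
  (-(1 / 2 : ℂ) * ∑ j, ∑ k, pairing w (p k) (p j) * pairing w (p j) (p k)).re

theorem conj_pairing {N : ℕ} (w : Fin N → ℝ) (u v : Fin N → ℂ) :
    starRingEnd ℂ (pairing w u v) = pairing w v u := by
  simp only [pairing, map_sum, map_mul, Complex.conj_conj, Complex.conj_ofReal]
  exact Finset.sum_congr rfl fun α _ => by ring

theorem hamiltonian_eq {n N : ℕ} (w : Fin N → ℝ) (p : Phase n N) :
    (hamiltonian w p : ℂ) =
      -(1 / 2 : ℂ) * ∑ j, ∑ k, pairing w (p k) (p j) * pairing w (p j) (p k) := by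
  unfold hamiltonian
  apply Complex.conj_eq_iff_re.mp
  simp only [map_mul, map_neg, map_div₀, map_one, map_ofNat, map_sum, conj_pairing]
  congr 1
  exact Finset.sum_congr rfl fun j _ => Finset.sum_congr rfl fun k _ => mul_comm _ _

/-- The diagonal of `(1 - Λ)⁻¹`, where `Λ = diag(λ_1, …, λ_N)`. -/
noncomputable def weightX {N : ℕ} (lam : Fin N → ℝ) (α : Fin N) : ℝ := (1 - lam α)⁻¹

/-- The diagonal of `(1 + Λ)⁻¹`, where `Λ = diag(λ_1, …, λ_N)`. -/
noncomputable def weightT {N : ℕ} (lam : Fin N → ℝ) (α : Fin N) : ℝ := (1 + lam α)⁻¹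

/-- `H^x = -½ ∑_{j,k} ⟨Φ_k, (1 - Λ)⁻¹ Φ_j⟩ ⟨Φ_j, (1 - Λ)⁻¹ Φ_k⟩`. -/
noncomputable def Hx (n : ℕ) {N : ℕ} (lam : Fin N → ℝ) : Phase n N → ℝ :=
  hamiltonian (weightX lam)

/-- `H^t = -½ ∑_{j,k} ⟨Φ_k, (1 + Λ)⁻¹ Φ_j⟩ ⟨Φ_j, (1 + Λ)⁻¹ Φ_k⟩`. -/
noncomputable def Ht (n : ℕ) {N : ℕ} (lam : Fin N → ℝ) : Phase n N → ℝ :=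
  hamiltonian (weightT lam)

/-- `P_{jk} = i ⟨Φ_k, (1 - Λ)⁻¹ Φ_j⟩`. -/
noncomputable def fieldP {n N : ℕ} (lam : Fin N → ℝ) (p : Phase n N) :
    Matrix (Fin n) (Fin n) ℂ :=
  Matrix.of fun j k => Complex.I * pairing (weightX lam) (p k) (p j)

/-- `Q_{jk} = i ⟨Φ_k, (1 + Λ)⁻¹ Φ_j⟩`. -/
noncomputable def fieldQ {n N : ℕ} (lam : Fin N → ℝ) (p : Phase n N) :
    Matrix (Fin n) (Fin n) ℂ :=
  Matrix.of fun j k => Complex.I * pairing (weightT lam) (p k) (p j)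

/-- `φ` is a (classical) solution, on the open set `U` of points `(x, t)`, of both Hamiltonian
systems `i φ_{jα,x} = ∂H^x/∂φ̄_{jα}` and `i φ_{jα,t} = ∂H^t/∂φ̄_{jα}`.  As the Hamiltonians are real,
the equations for `φ̄_{jα}` are the complex conjugates of these. -/
structure IsHamiltonianSolution {n N : ℕ} (lam : Fin N → ℝ) (U : Set (ℝ × ℝ))
    (φ : ℝ × ℝ → Phase n N) : Prop where
  contDiffOn : ContDiffOn ℝ 1 φ U
  eq_x : ∀ x t, (x, t) ∈ U → ∀ j α,
    Complex.I * deriv (fun s => φ (s, t) j α) x = dPhiBar (Hx n lam) j α (φ (x, t))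
  eq_t : ∀ x t, (x, t) ∈ U → ∀ j α,
    Complex.I * deriv (fun s => φ (x, s) j α) t = dPhiBar (Ht n lam) j α (φ (x, t))

/-! ### The principal chiral field equations -/

/-- `u(n)`: the matrices `A` with `A^* + A = 0`. -/
def uLie (n : ℕ) : Set (Matrix (Fin n) (Fin n) ℂ) :=
  {A | A.conjTranspose + A = 0}

/-- `su(n)`: the matrices in `u(n)` with trace `0`. -/
def suLie (n : ℕ) : Set (Matrix (Fin n) (Fin n) ℂ) :=
  {A | A ∈ uLie n ∧ A.trace = 0}

/-- The partial derivative with respect to `x` of a matrix function of `(x, t)`. -/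
noncomputable def partialX {n : ℕ} (A : ℝ × ℝ → Matrix (Fin n) (Fin n) ℂ) (x t : ℝ) :
    Matrix (Fin n) (Fin n) ℂ :=
  Matrix.of fun j k => deriv (fun s => A (s, t) j k) x

/-- The partial derivative with respect to `t` of a matrix function of `(x, t)`. -/
noncomputable def partialT {n : ℕ} (A : ℝ × ℝ → Matrix (Fin n) (Fin n) ℂ) (x t : ℝ) :
    Matrix (Fin n) (Fin n) ℂ :=
  Matrix.of fun j k => deriv (fun s => A (x, s) j k) t

/-- `(P, Q)` is a (classical) solution with values in `𝔤`, on the open set `U` of points `(x, t)`,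
of the principal chiral field equations `P_t + Q_x = 0` and `P_t - Q_x + [P, Q] = 0`. -/
structure IsChiralSolution {n : ℕ} (𝔤 : Set (Matrix (Fin n) (Fin n) ℂ)) (U : Set (ℝ × ℝ))
    (P Q : ℝ × ℝ → Matrix (Fin n) (Fin n) ℂ) : Prop where
  contDiffOn_P : ∀ j k, ContDiffOn ℝ 1 (fun z => P z j k) U
  contDiffOn_Q : ∀ j k, ContDiffOn ℝ 1 (fun z => Q z j k) U
  mem_P : ∀ z ∈ U, P z ∈ 𝔤
  mem_Q : ∀ z ∈ U, Q z ∈ 𝔤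
  eq_conservation : ∀ x t, (x, t) ∈ U → partialT P x t + partialX Q x t = 0
  eq_compatibility : ∀ x t, (x, t) ∈ U →
    partialT P x t - partialX Q x t + (P (x, t) * Q (x, t) - Q (x, t) * P (x, t)) = 0

end ChiralField

/-!
For `φ_α = (φ_{1α}, …, φ_{nα}) ∈ ℂⁿ` write `G_{αβ} = φ_α^* φ_β` (`gram`).  Both Hamiltonians are
quartic functions `∑ c_{αβ} |G_{αβ}|²` (`quartic`, `hamiltonian_eq_quartic`) whose coefficients are
off the diagonal divided differences `c_{αβ} = (u_α - u_β) / (λ_α - λ_β)`: for the weights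
`w_α = (1 - λ_α)⁻¹` the resolvent identity `w_α w_β = (w_α - w_β) / (λ_α - λ_β)` holds, and
similarly for `(1 + λ_α)⁻¹` with the opposite sign.

*Involution.*  The bracket of two such quartic functions is
`8 ∑ c_{αβ} d_{αγ} Im (G_{αβ} G_{βγ} G_{γα})`.  The imaginary part is totally antisymmetric in
`α, β, γ`, and the antisymmetrization of `c_{αβ} d_{αγ}` vanishes for divided differences by
`∑_{cyc} 1 / ((λ_α - λ_β) (λ_α - λ_γ)) = 0` (`sum_dividedDifference_mul_eq_zero`).  Every such
quartic function is invariant under the phase rotations of the single `φ_α` and under the unitary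
group of `ℂⁿ`, so it also commutes with the moment maps `|φ_α|²` and `∑_α |φ_{jα}|²`.

*Integrals for `n = 2`.*  Choose a distinguished site `o`.  The integrals are the `N` norms
`|φ_α|²`, the sum `∑_α |φ_{1α}|²`, and the `N - 1` Gaudin Hamiltonians
`2 ∑_{β ≠ μ} |G_{μβ}|² / (λ_μ - λ_β)` with `μ ≠ o` (the one with `μ = o` is minus the sum of the
others).  At the point with `φ_o = (1, 1)` and `φ_α = (1, 0)` for `α ≠ o`, and on suitable test
vectors, their Jacobian is block triangular with nonzero diagonal
(`linearIndependent_gaudinIntegral_basePoint`).  As the Jacobian determinant is analytic, it is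
nonzero on a dense open set (`exists_dense_linearIndependent_fderiv`).

*Chiral field.*  The Hamiltonian systems read `φ_x = (1 - Λ)⁻¹ P φ` and `φ_t = (1 + Λ)⁻¹ Q φ`.  Put
`S_{jk} = i ⟨Φ_k, (1 - Λ²)⁻¹ Φ_j⟩`.  Then `P_t = [Q, S]` and `Q_x = [P, S]`
(`hasDerivAt_field`), while `P + Q = 2 S`; hence `P_t = ½ [Q, P] = -Q_x`, which are the chiral field
equations.  They force the traces of `P_t` and `Q_x` to vanish, and scalar matrices are central, so
the traceless parts solve the same equations (`IsChiralSolution.tracelessPart`).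
-/

open scoped ContDiff

namespace ChiralField

/-! ### Quadratic and quartic functions on the phase space -/

/-- The Hermitian product `φ_α^* φ_β` of the vectors `φ_α = (φ_{jα})_j` in `ℂⁿ`. -/
noncomputable def gram {n N : ℕ} (p : Phase n N) (α β : Fin N) : ℂ :=
  ∑ j, starRingEnd ℂ (p j α) * p j β

/-- The quartic function `∑_{α,β} c_{αβ} |φ_α^* φ_β|²`. -/
noncomputable def quartic {n N : ℕ} (c : Fin N → Fin N → ℝ) (p : Phase n N) : ℝ :=
  ∑ α, ∑ β, c α β * Complex.normSq (gram p α β)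

/-- The quadratic function `∑_{j,α} h_{jα} |φ_{jα}|²`. -/
noncomputable def quadratic {n N : ℕ} (h : Fin n → Fin N → ℝ) (p : Phase n N) : ℝ :=
  ∑ j, ∑ α, h j α * Complex.normSq (p j α)

theorem conj_gram {n N : ℕ} (p : Phase n N) (α β : Fin N) :
    starRingEnd ℂ (gram p α β) = gram p β α := by
  simp only [gram, map_sum, map_mul, Complex.conj_conj]
  exact Finset.sum_congr rfl fun j _ => mul_comm _ _

theorem contDiff_normSq {m : WithTop ℕ∞} : ContDiff ℝ m Complex.normSq := by
  have : (Complex.normSq : ℂ → ℝ) = fun z => ‖z‖ ^ 2 := by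
    ext z; exact Complex.normSq_eq_norm_sq z
  rw [this]
  exact contDiff_norm_sq ℝ

theorem contDiff_coord {n N : ℕ} {m : WithTop ℕ∞} (j : Fin n) (α : Fin N) :
    ContDiff ℝ m fun p : Phase n N => p j α :=
  (contDiff_apply_apply ℝ ℂ j α)

theorem contDiff_gram {n N : ℕ} {m : WithTop ℕ∞} (α β : Fin N) :
    ContDiff ℝ m fun p : Phase n N => gram p α β :=
  ContDiff.sum fun j _ =>
    (Complex.conjCLE.contDiff.comp (contDiff_coord j α)).mul (contDiff_coord j β)

theorem contDiff_quartic {n N : ℕ} {m : WithTop ℕ∞} (c : Fin N → Fin N → ℝ) :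
    ContDiff ℝ m (quartic (n := n) c) :=
  ContDiff.sum fun α _ => ContDiff.sum fun β _ =>
    contDiff_const.mul (contDiff_normSq.comp (contDiff_gram α β))

theorem contDiff_quadratic {n N : ℕ} {m : WithTop ℕ∞} (h : Fin n → Fin N → ℝ) :
    ContDiff ℝ m (quadratic h) :=
  ContDiff.sum fun j _ => ContDiff.sum fun α _ =>
    contDiff_const.mul (contDiff_normSq.comp (contDiff_coord j α))

/-! ### Gradients and the Poisson bracket -/

theorem hasDerivAt_normSq {z : ℝ → ℂ} {z' : ℂ} {s : ℝ} (hz : HasDerivAt z z' s) :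
    HasDerivAt (fun s => Complex.normSq (z s)) (2 * (starRingEnd ℂ (z s) * z').re) s := by
  have hre := (Complex.reCLM.hasFDerivAt (x := z s)).comp_hasDerivAt s hz
  have him := (Complex.imCLM.hasFDerivAt (x := z s)).comp_hasDerivAt s hz
  have h := (hre.fun_mul hre).fun_add (him.fun_mul him)
  refine h.congr_deriv ?_
  simp only [Complex.mul_re, Complex.conj_re, Complex.conj_im, Complex.reCLM_apply,
    Complex.imCLM_apply, Function.comp_apply]
  ring

theorem hasDerivAt_mul_conj {y z : ℝ → ℂ} {y' z' : ℂ} {s : ℝ} (hy : HasDerivAt y y' s)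
    (hz : HasDerivAt z z' s) :
    HasDerivAt (fun s => starRingEnd ℂ (y s) * z s)
      (starRingEnd ℂ y' * z s + starRingEnd ℂ (y s) * z') s :=
  HasDerivAt.fun_mul (hy.star) hz

theorem hasDerivAt_line {n N : ℕ} (p v : Phase n N) (j : Fin n) (α : Fin N) :
    HasDerivAt (fun s : ℝ => (p + s • v) j α) (v j α) 0 := by
  have h := ((hasDerivAt_id (0 : ℝ)).ofReal_comp.mul_const (v j α)).const_add (p j α)
  simpa using h

theorem fderiv_eq_of_line {E : Type*} [NormedAddCommGroup E] [NormedSpace ℝ E] {f : E → ℝ} {p v : E}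
    {d : ℝ} (hf : DifferentiableAt ℝ f p) (h : HasDerivAt (fun s : ℝ => f (p + s • v)) d 0) :
    fderiv ℝ f p v = d :=
  hf.lineDeriv_eq_fderiv.symm.trans (HasLineDerivAt.lineDeriv h)

/-- The differential of `f` at `p` is `v ↦ 2 Re ∑_{j,α} ḡ_{jα} v_{jα}`; the factor `2` makes `g` the
vector of the Wirtinger derivatives `∂f/∂φ̄_{jα}`. -/
def HasGradient {n N : ℕ} (f : Phase n N → ℝ) (g : Phase n N) (p : Phase n N) : Prop :=
  ∀ v, fderiv ℝ f p v = 2 * ∑ j, ∑ α, (starRingEnd ℂ (g j α) * v j α).re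

/-- A sum over all coordinates against `coordVec j α c` reduces to its `(j, α)` term. -/
theorem sum_coordVec {n N : ℕ} (g : Phase n N) (j : Fin n) (α : Fin N) (c : ℂ) :
    ∑ k, ∑ β, (starRingEnd ℂ (g k β) * coordVec j α c k β).re =
      (starRingEnd ℂ (g j α) * c).re := by
  rw [Finset.sum_eq_single j, Finset.sum_eq_single α]
  · simp [coordVec]
  · intro β _ hβ; simp [coordVec, hβ]
  · simp
  · intro k _ hk; simp [coordVec, hk]
  · simp

theorem HasGradient.dPhiBar_eq {n N : ℕ} {f : Phase n N → ℝ} {g p : Phase n N}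
    (h : HasGradient f g p) (j : Fin n) (α : Fin N) : dPhiBar f j α p = g j α := by
  unfold dPhiBar
  rw [h, h, sum_coordVec, sum_coordVec]
  apply Complex.ext <;> simp

theorem HasGradient.dPhi_eq {n N : ℕ} {f : Phase n N → ℝ} {g p : Phase n N}
    (h : HasGradient f g p) (j : Fin n) (α : Fin N) :
    dPhi f j α p = starRingEnd ℂ (g j α) := by
  unfold dPhi
  rw [h, h, sum_coordVec, sum_coordVec]
  apply Complex.ext <;> simp

/-- The bracket is `2 Im ∑_{j,α} ḡ₁ g₂`, so it vanishes when this sum is real. -/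
theorem HasGradient.poisson_eq_zero {n N : ℕ} {f₁ f₂ : Phase n N → ℝ} {g₁ g₂ p : Phase n N}
    (h₁ : HasGradient f₁ g₁ p) (h₂ : HasGradient f₂ g₂ p)
    (h : (∑ j, ∑ α, starRingEnd ℂ (g₁ j α) * g₂ j α).im = 0) : poisson f₁ f₂ p = 0 := by
  have hc := Complex.conj_eq_iff_im.mpr h
  simp only [map_sum, map_mul, Complex.conj_conj] at hc
  unfold poisson
  simp only [h₁.dPhiBar_eq, h₁.dPhi_eq, h₂.dPhiBar_eq, h₂.dPhi_eq, Finset.sum_sub_distrib]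
  rw [← hc]
  simp only [mul_comm, sub_self, zero_mul]

theorem poisson_swap {n N : ℕ} (f g : Phase n N → ℝ) (p : Phase n N) :
    poisson g f p = -poisson f g p := by
  simp only [poisson, ← mul_neg, ← Finset.sum_neg_distrib, neg_sub]

theorem hasGradient_quadratic {n N : ℕ} (h : Fin n → Fin N → ℝ) (p : Phase n N) :
    HasGradient (quadratic h) (fun j α => (h j α : ℂ) * p j α) p := by
  intro v
  have hd : HasDerivAt (fun s : ℝ => quadratic h (p + s • v))
      (∑ j, ∑ α, h j α * (2 * (starRingEnd ℂ (p j α) * v j α).re)) 0 := by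
    refine HasDerivAt.fun_sum fun j _ => HasDerivAt.fun_sum fun α _ => HasDerivAt.const_mul _ ?_
    simpa using hasDerivAt_normSq (hasDerivAt_line p v j α)
  rw [fderiv_eq_of_line ((contDiff_quadratic (m := 1) h).differentiable one_ne_zero p) hd]
  simp only [Finset.mul_sum]
  refine Finset.sum_congr rfl fun j _ => Finset.sum_congr rfl fun α _ => ?_
  simp only [map_mul, Complex.conj_ofReal, mul_assoc, Complex.re_ofReal_mul]
  ring

/-- By the symmetry of `c` both factors of each `|φ_α^* φ_β|²` contribute the same to the gradient. -/
theorem hasGradient_quartic {n N : ℕ} {c : Fin N → Fin N → ℝ} (hc : ∀ α β, c α β = c β α)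
    (p : Phase n N) :
    HasGradient (quartic c) (fun j α => 2 * ∑ β, (c α β : ℂ) * gram p β α * p j β) p := by
  intro v
  set y : Fin N → Fin N → ℂ := fun α β => ∑ j, starRingEnd ℂ (p j α) * v j β with hy
  have hd : HasDerivAt (fun s : ℝ => quartic c (p + s • v))
      (∑ α, ∑ β, c α β *
        (2 * (starRingEnd ℂ (gram p α β) * (starRingEnd ℂ (y β α) + y α β)).re)) 0 := by
    refine HasDerivAt.fun_sum fun α _ => HasDerivAt.fun_sum fun β _ => HasDerivAt.const_mul _ ?_
    have hg : HasDerivAt (fun s : ℝ => gram (p + s • v) α β)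
        (starRingEnd ℂ (y β α) + y α β) 0 := by
      have h := HasDerivAt.fun_sum (u := Finset.univ) fun j _ =>
        hasDerivAt_mul_conj (hasDerivAt_line p v j α) (hasDerivAt_line p v j β)
      refine h.congr_deriv ?_
      simp only [zero_smul, add_zero, hy, map_sum, map_mul, Complex.conj_conj, ← Finset.sum_add_distrib]
      exact Finset.sum_congr rfl fun j _ => by ring
    simpa using hasDerivAt_normSq hg
  rw [fderiv_eq_of_line ((contDiff_quartic (m := 1) c).differentiable one_ne_zero p) hd]
  -- both halves of the product rule contribute the same, by the symmetry of `c`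
  have h1 : ∑ α, ∑ β, c α β *
        (2 * (starRingEnd ℂ (gram p α β) * (starRingEnd ℂ (y β α) + y α β)).re) =
      2 * ∑ α, ∑ β, 2 * (c α β * (gram p α β * y β α).re) := by
    have h2 : ∀ α β, c α β *
        (2 * (starRingEnd ℂ (gram p α β) * (starRingEnd ℂ (y β α) + y α β)).re) =
        2 * (c α β * (gram p α β * y β α).re) + 2 * (c β α * (gram p β α * y α β).re) := by
      intro α β
      rw [mul_add, Complex.add_re, ← map_mul, Complex.conj_re, conj_gram, hc β α]
      ring
    simp only [h2, Finset.sum_add_distrib]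
    rw [Finset.sum_comm (f := fun α β => 2 * (c β α * (gram p β α * y α β).re))]
    simp only [← Finset.mul_sum]
    ring
  rw [h1]
  congr 1
  have h3 : ∀ α, ∑ β, 2 * (c α β * (gram p α β * y β α).re) =
      ∑ j, (starRingEnd ℂ (2 * ∑ β, (c α β : ℂ) * gram p β α * p j β) * v j α).re := by
    intro α
    have h4 : ∀ (a : ℝ) (z : ℂ), 2 * (a * z.re) = (2 * (a * z)).re := by simp
    simp only [h4, ← Complex.re_sum, hy, map_mul, map_sum, Complex.conj_ofReal, conj_gram,
      Finset.mul_sum, Finset.sum_mul, map_ofNat]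
    rw [Finset.sum_comm]
    refine congrArg _ (Finset.sum_congr rfl fun j _ => Finset.sum_congr rfl fun β _ => ?_)
    ring
  rw [Finset.sum_comm (s := Finset.univ (α := Fin n))]
  exact Finset.sum_congr rfl fun α _ => h3 α

/-! ### Involution -/

theorem poisson_quadratic_quadratic {n N : ℕ} (h k : Fin n → Fin N → ℝ) (p : Phase n N) :
    poisson (quadratic h) (quadratic k) p = 0 := by
  refine (hasGradient_quadratic h p).poisson_eq_zero (hasGradient_quadratic k p) ?_
  refine Complex.conj_eq_iff_im.mp ?_
  simp only [map_sum, map_mul, Complex.conj_conj, Complex.conj_ofReal]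
  exact Finset.sum_congr rfl fun j _ => Finset.sum_congr rfl fun α _ => by ring

/-- Quartic functions are invariant under the phase rotations `φ_α ↦ e^{iθ_α} φ_α` of each site. -/
theorem poisson_siteQuadratic_quartic {n N : ℕ} (b : Fin N → ℝ) {c : Fin N → Fin N → ℝ}
    (hc : ∀ α β, c α β = c β α) (p : Phase n N) :
    poisson (quadratic fun _ => b) (quartic c) p = 0 := by
  refine (hasGradient_quadratic _ p).poisson_eq_zero (hasGradient_quartic hc p) ?_
  have h : ∑ j, ∑ α, starRingEnd ℂ ((b α : ℂ) * p j α) *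
        (2 * ∑ β, (c α β : ℂ) * gram p β α * p j β) =
      ∑ α, ∑ β, ((2 * b α * c α β : ℝ) : ℂ) * (gram p β α * gram p α β) := by
    rw [Finset.sum_comm]
    refine Finset.sum_congr rfl fun α _ => ?_
    simp only [Finset.mul_sum]
    rw [Finset.sum_comm]
    refine Finset.sum_congr rfl fun β _ => ?_
    rw [gram.eq_1 p α β]
    simp only [Finset.mul_sum]
    refine Finset.sum_congr rfl fun j _ => ?_
    simp only [map_mul, Complex.conj_ofReal]
    push_cast
    ring
  rw [h]
  refine Complex.conj_eq_iff_im.mp ?_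
  simp only [map_sum, map_mul, conj_gram, Complex.conj_ofReal]
  exact Finset.sum_congr rfl fun α _ => Finset.sum_congr rfl fun β _ => by ring

/-- Quartic functions are invariant under the diagonal unitary matrices acting on `ℂⁿ`. -/
theorem poisson_componentQuadratic_quartic {n N : ℕ} (a : Fin n → ℝ) {c : Fin N → Fin N → ℝ}
    (hc : ∀ α β, c α β = c β α) (p : Phase n N) :
    poisson (quadratic fun j _ => a j) (quartic c) p = 0 := by
  refine (hasGradient_quadratic _ p).poisson_eq_zero (hasGradient_quartic hc p) ?_
  refine Complex.conj_eq_iff_im.mp ?_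
  simp only [map_sum, map_mul, conj_gram, Complex.conj_conj, Complex.conj_ofReal, map_ofNat,
    Finset.mul_sum]
  refine Finset.sum_congr rfl fun j _ => ?_
  rw [Finset.sum_comm]
  refine Finset.sum_congr rfl fun α _ => Finset.sum_congr rfl fun β _ => ?_
  rw [hc β α]
  ring

/-- Off the diagonal, `c` is the matrix of divided differences at the nodes `λ_α` of the values `u_α`.
The diagonal is left free: it only contributes functions of the `|φ_α|²`. -/
def IsDividedDifference {N : ℕ} (lam : Fin N → ℝ) (c : Fin N → Fin N → ℝ) : Prop :=
  ∃ u : Fin N → ℝ, ∀ α β, α ≠ β → c α β = (u α - u β) / (lam α - lam β)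

/-- Against a totally antisymmetric `T` only the antisymmetric part of `c_{αβ} d_{αγ}` matters, and it
vanishes for divided differences: in the cyclic sum
`(u_α - u_β) (v_α - v_γ) - (u_α - u_γ) (v_α - v_β)` is a common factor, multiplied by
`∑_{cyc} 1 / ((λ_α - λ_β) (λ_α - λ_γ)) = 0`. -/
theorem sum_dividedDifference_mul_eq_zero {N : ℕ} {lam : Fin N → ℝ}
    (hinj : Function.Injective lam) {c d : Fin N → Fin N → ℝ}
    (hc : IsDividedDifference lam c) (hd : IsDividedDifference lam d)
    {T : Fin N → Fin N → Fin N → ℝ} (hcyc : ∀ α β γ, T β γ α = T α β γ)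
    (hanti : ∀ α β γ, T α γ β = -T α β γ) :
    ∑ α, ∑ β, ∑ γ, c α β * d α γ * T α β γ = 0 := by
  obtain ⟨u, hu⟩ := hc
  obtain ⟨v, hv⟩ := hd
  have hrot : ∀ f : Fin N → Fin N → Fin N → ℝ,
      ∑ α, ∑ β, ∑ γ, f β γ α = ∑ α, ∑ β, ∑ γ, f α β γ := by
    intro f
    rw [Finset.sum_comm]
    refine Finset.sum_congr rfl fun α _ => ?_
    rw [Finset.sum_comm]
  have hrotT : ∀ f : Fin N → Fin N → Fin N → ℝ,
      ∑ α, ∑ β, ∑ γ, f β γ α * T α β γ = ∑ α, ∑ β, ∑ γ, f α β γ * T α β γ := by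
    intro f
    rw [← hrot fun α β γ => f α β γ * T α β γ]
    simp only [hcyc]
  have hswapT : ∀ f : Fin N → Fin N → Fin N → ℝ,
      ∑ α, ∑ β, ∑ γ, f α γ β * T α β γ = -∑ α, ∑ β, ∑ γ, f α β γ * T α β γ := by
    intro f
    simp only [← Finset.sum_neg_distrib]
    refine Finset.sum_congr rfl fun α _ => ?_
    rw [Finset.sum_comm]
    refine Finset.sum_congr rfl fun β _ => Finset.sum_congr rfl fun γ _ => ?_
    rw [hanti, mul_neg]
  have h1 := hrotT fun α β γ => c α β * d α γ
  have h2 := hrotT fun α β γ => c β γ * d β α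
  have h3 := hswapT fun α β γ => c α β * d α γ
  have h4 := hrotT fun α β γ => c α γ * d α β
  have h5 := hrotT fun α β γ => c β α * d β γ
  -- `T` is antisymmetrized: the summand is `T` times a cyclic sum that vanishes off the diagonals
  have h6 : ∑ α, ∑ β, ∑ γ, (c α β * d α γ * T α β γ + c β γ * d β α * T α β γ
      + c γ α * d γ β * T α β γ - c α γ * d α β * T α β γ - c β α * d β γ * T α β γ
      - c γ β * d γ α * T α β γ) = 0 := by
    refine Finset.sum_eq_zero fun α _ => Finset.sum_eq_zero fun β _ =>
      Finset.sum_eq_zero fun γ _ => ?_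
    by_cases hβγ : β = γ
    · have := hanti α β γ
      subst hβγ
      have h0 : T α β β = 0 := by linarith
      simp [h0]
    by_cases hαγ : α = γ
    · have h := hanti β α γ
      have h' := hcyc α β γ
      subst hαγ
      have h0 : T α β α = 0 := by linarith
      simp [h0]
    by_cases hαβ : α = β
    · have h := hanti γ α β
      have h' := hcyc γ α β
      subst hαβ
      have h0 : T α α γ = 0 := by linarith
      simp [h0]
    have e1 : lam α - lam β ≠ 0 := sub_ne_zero.mpr (hinj.ne hαβ)
    have e2 : lam β - lam γ ≠ 0 := sub_ne_zero.mpr (hinj.ne hβγ)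
    have e3 : lam γ - lam α ≠ 0 := sub_ne_zero.mpr (hinj.ne (Ne.symm hαγ))
    have hneg : ∀ (w : Fin N → ℝ) (α β : Fin N),
        (w β - w α) / (lam β - lam α) = (w α - w β) / (lam α - lam β) := by
      intro w α β
      rw [← neg_sub (w α), ← neg_sub (lam α), neg_div_neg_eq]
    rw [hu _ _ hαβ, hu _ _ (Ne.symm hαβ), hu _ _ hβγ, hu _ _ (Ne.symm hβγ), hu _ _ hαγ,
      hu _ _ (Ne.symm hαγ), hv _ _ hαβ, hv _ _ (Ne.symm hαβ), hv _ _ hβγ, hv _ _ (Ne.symm hβγ),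
      hv _ _ hαγ, hv _ _ (Ne.symm hαγ), hneg u α β, hneg v α β, hneg u β γ, hneg v β γ,
      hneg u γ α, hneg v γ α]
    field_simp
    ring
  simp only [Finset.sum_add_distrib, Finset.sum_sub_distrib, h5, h4, h3, h2, h1] at h6
  linarith

theorem poisson_quartic_quartic {n N : ℕ} {lam : Fin N → ℝ} (hinj : Function.Injective lam)
    {c d : Fin N → Fin N → ℝ} (hc : ∀ α β, c α β = c β α) (hd : ∀ α β, d α β = d β α)
    (hc' : IsDividedDifference lam c) (hd' : IsDividedDifference lam d) (p : Phase n N) :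
    poisson (quartic c) (quartic d) p = 0 := by
  refine (hasGradient_quartic hc p).poisson_eq_zero (hasGradient_quartic hd p) ?_
  set T : Fin N → Fin N → Fin N → ℝ :=
    fun α β γ => (gram p α β * gram p β γ * gram p γ α).im with hT
  have h : ∑ j, ∑ α, starRingEnd ℂ (2 * ∑ β, (c α β : ℂ) * gram p β α * p j β) *
        (2 * ∑ γ, (d α γ : ℂ) * gram p γ α * p j γ) =
      ∑ α, ∑ β, ∑ γ, ((4 * (c α β * d α γ) : ℝ) : ℂ) *
        (gram p α β * gram p β γ * gram p γ α) := by
    rw [Finset.sum_comm]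
    refine Finset.sum_congr rfl fun α _ => ?_
    simp only [map_mul, map_sum, map_ofNat, conj_gram, Complex.conj_ofReal, Finset.mul_sum,
      Finset.sum_mul]
    rw [Finset.sum_comm]
    refine (Finset.sum_congr rfl fun γ _ => Finset.sum_comm).trans ?_
    rw [Finset.sum_comm]
    refine Finset.sum_congr rfl fun β _ => Finset.sum_congr rfl fun γ _ => ?_
    rw [gram.eq_1 p β γ]
    simp only [Finset.mul_sum, Finset.sum_mul]
    refine Finset.sum_congr rfl fun j _ => ?_
    push_cast
    ring
  have h0 := sum_dividedDifference_mul_eq_zero hinj hc' hd' (T := T)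
    (fun α β γ => by simp only [hT]; congr 1; ring)
    (fun α β γ => by
      simp only [hT]
      rw [← Complex.conj_im]
      simp only [map_mul, conj_gram]
      congr 1
      ring)
  rw [h]
  simp only [Complex.im_sum, Complex.im_ofReal_mul]
  simp only [hT] at h0
  simp only [mul_assoc, ← Finset.mul_sum] at h0 ⊢
  rw [h0, mul_zero]

/-! ### Independence on a dense open set -/

/-- Analytic functions whose differentials are independent at one point, as seen on as many test
vectors `e k` as there are functions, have independent differentials on a dense open set: the set
where the Jacobian determinant on the `e k` does not vanish. -/
theorem exists_dense_linearIndependent_fderiv {E ι : Type*} [NormedAddCommGroup E]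
    [NormedSpace ℝ E] [Fintype ι] [DecidableEq ι] {F : ι → E → ℝ}
    (hF : ∀ i, ContDiff ℝ ω (F i)) (q : E) (e : ι → E)
    (h : LinearIndependent ℝ fun i k => fderiv ℝ (F i) q (e k)) :
    ∃ V : Set E, IsOpen V ∧ Dense V ∧
      ∀ p ∈ V, LinearIndependent ℝ fun i => fderiv ℝ (F i) p := by
  set D : E → ℝ := fun p => (Matrix.of fun i k => fderiv ℝ (F i) p (e k)).det with hD
  have hdet : ∀ p, D p ≠ 0 ↔ LinearIndependent ℝ fun i k => fderiv ℝ (F i) p (e k) := by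
    intro p
    rw [← isUnit_iff_ne_zero, ← Matrix.isUnit_iff_isUnit_det,
      ← Matrix.linearIndependent_rows_iff_isUnit]
    rfl
  have hsmooth : ContDiff ℝ ω D := by
    simp only [hD, Matrix.det_apply']
    refine ContDiff.sum fun σ _ => contDiff_const.mul (contDiff_prod fun i _ => ?_)
    exact ((hF (σ i)).fderiv_right (m := ω) le_rfl).clm_apply contDiff_const
  refine ⟨{p | D p ≠ 0}, isOpen_ne_fun hsmooth.continuous continuous_const, ?_, ?_⟩
  · have han : AnalyticOnNhd ℝ D Set.univ := contDiff_omega_iff_analyticOnNhd.mp hsmooth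
    intro p
    by_contra hp
    -- near a point outside the closure `D` vanishes, so it would vanish identically
    have hev : D =ᶠ[nhds p] 0 := by
      have : (closure {p | D p ≠ 0})ᶜ ∈ nhds p := isClosed_closure.isOpen_compl.mem_nhds hp
      filter_upwards [this] with x hx
      by_contra hx'
      exact hx (subset_closure hx')
    exact (hdet q).mpr h
      (han.eqOn_zero_of_preconnected_of_eventuallyEq_zero isPreconnected_univ
        (Set.mem_univ p) hev (Set.mem_univ q))
  · intro p hp
    exact LinearIndependent.of_comp
      (LinearMap.pi fun k => (ContinuousLinearMap.apply ℝ ℝ (e k)).toLinearMap) ((hdet p).mp hp)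

/-! ### The Hamiltonian flows of the matrices `P` and `Q` -/

theorem hamiltonian_eq_quartic {n N : ℕ} (w : Fin N → ℝ) :
    hamiltonian (n := n) w = quartic fun α β => -(1 / 2) * (w α * w β) := by
  ext p
  rw [← Complex.ofReal_inj, hamiltonian_eq]
  have h : ∑ j, ∑ k, pairing w (p k) (p j) * pairing w (p j) (p k) =
      ∑ α, ∑ β, ((w α * w β : ℝ) : ℂ) * (gram p α β * gram p β α) := by
    let f : Fin n → Fin n → Fin N → Fin N → ℂ := fun j k α β =>
      (starRingEnd ℂ (p k α) * (w α * p j α)) * (starRingEnd ℂ (p j β) * (w β * p k β))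
    calc
      _ = ∑ j, ∑ k, ∑ α, ∑ β, f j k α β := by
        refine Finset.sum_congr rfl fun j _ => Finset.sum_congr rfl fun k _ => ?_
        simp only [pairing, Finset.sum_mul_sum, f]
      _ = ∑ j, ∑ α, ∑ β, ∑ k, f j k α β := by
        refine Finset.sum_congr rfl fun j _ => ?_
        rw [Finset.sum_comm]
        exact Finset.sum_congr rfl fun α _ => Finset.sum_comm
      _ = ∑ α, ∑ β, ∑ j, ∑ k, f j k α β := by
        rw [Finset.sum_comm]
        exact Finset.sum_congr rfl fun α _ => Finset.sum_comm
      _ = _ := by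
        refine Finset.sum_congr rfl fun α _ => Finset.sum_congr rfl fun β _ => ?_
        rw [mul_comm (gram p α β), gram, gram, Finset.sum_mul_sum]
        simp only [Finset.mul_sum, f]
        refine Finset.sum_congr rfl fun j _ => Finset.sum_congr rfl fun k _ => ?_
        push_cast
        ring
  rw [h, quartic]
  push_cast
  simp only [Finset.mul_sum, Complex.normSq_eq_conj_mul_self, conj_gram]
  exact Finset.sum_congr rfl fun α _ => Finset.sum_congr rfl fun β _ => by ring

/-- The matrix `i ∑_α w_α φ_α φ_α^*`, with entries `i ⟨Φ_k, diag(w) Φ_j⟩`; `fieldP lam` and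
`fieldQ lam` are the cases `w = weightX lam` and `w = weightT lam`. -/
noncomputable def field {n N : ℕ} (w : Fin N → ℝ) (p : Phase n N) : Matrix (Fin n) (Fin n) ℂ :=
  Matrix.of fun j k => Complex.I * pairing w (p k) (p j)

theorem field_apply {n N : ℕ} (w : Fin N → ℝ) (p : Phase n N) (j k : Fin n) :
    field w p j k = ∑ α, Complex.I * w α * (starRingEnd ℂ (p k α) * p j α) := by
  simp only [field, Matrix.of_apply, pairing, Finset.mul_sum]
  exact Finset.sum_congr rfl fun α _ => by ring

theorem conj_field_apply {n N : ℕ} (w : Fin N → ℝ) (p : Phase n N) (j k : Fin n) :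
    starRingEnd ℂ (field w p j k) = -field w p k j := by
  simp only [field, Matrix.of_apply, map_mul, Complex.conj_I, conj_pairing, neg_mul]

/-- The Hamiltonian system of `hamiltonian w` is `φ_α' = w_α A φ_α`, where `A = field w p`. -/
theorem dPhiBar_hamiltonian {n N : ℕ} (w : Fin N → ℝ) (p : Phase n N) (j : Fin n) (α : Fin N) :
    dPhiBar (hamiltonian w) j α p = Complex.I * (w α * ∑ k, field w p j k * p k α) := by
  rw [hamiltonian_eq_quartic, (hasGradient_quartic (fun α β => by ring) p).dPhiBar_eq]
  simp only [field_apply, gram, Finset.mul_sum, Finset.sum_mul]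
  rw [Finset.sum_comm]
  refine Finset.sum_congr rfl fun k _ => Finset.sum_congr rfl fun β _ => ?_
  push_cast
  linear_combination (-(w α : ℂ) * w β * starRingEnd ℂ (p k β) * p k α * p j β) * Complex.I_sq

/-- Along `φ_α' = v_α A φ_α` with `A` skew-Hermitian, the matrix `i ∑_α w_α φ_α φ_α^*` evolves by the
commutator of `A` with `i ∑_α w_α v_α φ_α φ_α^*`. -/
theorem hasDerivAt_field {n N : ℕ} (w v : Fin N → ℝ) {γ : ℝ → Phase n N}
    {A : Matrix (Fin n) (Fin n) ℂ} {s : ℝ} (hA : A.conjTranspose = -A)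
    (hγ : ∀ j α, HasDerivAt (fun s => γ s j α) (v α * ∑ k, A j k * γ s k α) s) (j k : Fin n) :
    HasDerivAt (fun s => field w (γ s) j k)
      ((A * field (fun α => w α * v α) (γ s) - field (fun α => w α * v α) (γ s) * A) j k) s := by
  have hA' : ∀ a b, starRingEnd ℂ (A a b) = -A b a := fun a b => congrFun (congrFun hA b) a
  simp only [field_apply]
  refine (HasDerivAt.fun_sum fun α _ =>
    (hasDerivAt_mul_conj (hγ k α) (hγ j α)).const_mul (Complex.I * (w α : ℂ))).congr_deriv ?_
  simp only [Matrix.sub_apply, Matrix.mul_apply, field_apply, Finset.mul_sum, Finset.sum_mul,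
    map_mul, map_sum, hA', Complex.conj_ofReal, mul_add, Finset.sum_add_distrib]
  rw [sub_eq_neg_add, ← Finset.sum_neg_distrib]
  congr 1
  · rw [Finset.sum_comm]
    refine Finset.sum_congr rfl fun i _ => ?_
    rw [← Finset.sum_neg_distrib]
    refine Finset.sum_congr rfl fun α _ => ?_
    push_cast
    ring
  · rw [Finset.sum_comm]
    refine Finset.sum_congr rfl fun i _ => Finset.sum_congr rfl fun α _ => ?_
    push_cast
    ring

/-! ### The chiral field equations -/

theorem differentiableAt_slices {E : Type*} [NormedAddCommGroup E] [NormedSpace ℝ E]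
    {U : Set (ℝ × ℝ)} (hU : IsOpen U) {f : ℝ × ℝ → E} (hf : ContDiffOn ℝ 1 f U) {x t : ℝ}
    (h : (x, t) ∈ U) :
    DifferentiableAt ℝ (fun s => f (s, t)) x ∧ DifferentiableAt ℝ (fun s => f (x, s)) t := by
  have hd : DifferentiableAt ℝ f (x, t) :=
    (hf.contDiffAt (hU.mem_nhds h)).differentiableAt one_ne_zero
  exact ⟨DifferentiableAt.comp (f := fun s => (s, t)) x hd (by fun_prop),
    DifferentiableAt.comp (f := fun s => (x, s)) t hd (by fun_prop)⟩

theorem field_mem_uLie {n N : ℕ} (w : Fin N → ℝ) (p : Phase n N) : field w p ∈ uLie n := by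
  ext j k
  rw [Matrix.add_apply, Matrix.conjTranspose_apply, ← starRingEnd_apply, conj_field_apply]
  simp

theorem contDiffOn_field {n N : ℕ} (w : Fin N → ℝ) {U : Set (ℝ × ℝ)} {φ : ℝ × ℝ → Phase n N}
    (hφ : ContDiffOn ℝ 1 φ U) (j k : Fin n) : ContDiffOn ℝ 1 (fun z => field w (φ z) j k) U := by
  have hc : ∀ j α, ContDiffOn ℝ 1 (fun z => φ z j α) U := fun j α =>
    (contDiff_coord j α).comp_contDiffOn hφ
  simp only [field_apply]
  exact ContDiffOn.sum fun α _ => contDiffOn_const.mul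
    ((Complex.conjCLE.contDiff.comp_contDiffOn (hc k α)).mul (hc j α))

theorem weightX_add_weightT {N : ℕ} {lam : Fin N → ℝ} (hne : ∀ α, lam α ≠ 1 ∧ lam α ≠ -1)
    (α : Fin N) : weightX lam α + weightT lam α = 2 * (weightX lam α * weightT lam α) := by
  have h1 : 1 - lam α ≠ 0 := sub_ne_zero.mpr (hne α).1.symm
  have h2 : 1 + lam α ≠ 0 := fun h => (hne α).2 (by linarith)
  unfold weightX weightT
  field_simp
  ring

theorem fieldP_add_fieldQ {n N : ℕ} {lam : Fin N → ℝ} (hne : ∀ α, lam α ≠ 1 ∧ lam α ≠ -1)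
    (p : Phase n N) : fieldP lam p + fieldQ lam p =
      (2 : ℂ) • field (fun α => weightX lam α * weightT lam α) p := by
  ext j k
  change field (weightX lam) p j k + field (weightT lam) p j k = 2 * field _ p j k
  simp only [field_apply, ← Finset.sum_add_distrib, Finset.mul_sum]
  refine Finset.sum_congr rfl fun α _ => ?_
  have h : (weightX lam α + weightT lam α : ℂ) = 2 * (weightX lam α * weightT lam α) := by
    exact_mod_cast weightX_add_weightT hne α
  push_cast
  linear_combination Complex.I * (starRingEnd ℂ (p k α) * p j α) * h

theorem IsHamiltonianSolution.isChiralSolution {n N : ℕ} {lam : Fin N → ℝ}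
    (hne : ∀ α, lam α ≠ 1 ∧ lam α ≠ -1) {U : Set (ℝ × ℝ)} (hU : IsOpen U)
    {φ : ℝ × ℝ → Phase n N} (h : IsHamiltonianSolution lam U φ) :
    IsChiralSolution (uLie n) U (fun z => fieldP lam (φ z)) (fun z => fieldQ lam (φ z)) := by
  have hcoord : ∀ j α, ContDiffOn ℝ 1 (fun z => φ z j α) U := fun j α =>
    (contDiff_coord j α).comp_contDiffOn h.contDiffOn
  have hx : ∀ x t, (x, t) ∈ U → ∀ j α, HasDerivAt (fun s => φ (s, t) j α)
      (weightX lam α * ∑ k, fieldP lam (φ (x, t)) j k * φ (x, t) k α) x := by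
    intro x t hxt j α
    refine (differentiableAt_slices hU (hcoord j α) hxt).1.hasDerivAt.congr_deriv ?_
    have := h.eq_x x t hxt j α
    rw [Hx, dPhiBar_hamiltonian] at this
    exact mul_left_cancel₀ Complex.I_ne_zero this
  have ht : ∀ x t, (x, t) ∈ U → ∀ j α, HasDerivAt (fun s => φ (x, s) j α)
      (weightT lam α * ∑ k, fieldQ lam (φ (x, t)) j k * φ (x, t) k α) t := by
    intro x t hxt j α
    refine (differentiableAt_slices hU (hcoord j α) hxt).2.hasDerivAt.congr_deriv ?_
    have := h.eq_t x t hxt j α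
    rw [Ht, dPhiBar_hamiltonian] at this
    exact mul_left_cancel₀ Complex.I_ne_zero this
  set S : Phase n N → Matrix (Fin n) (Fin n) ℂ :=
    field fun α => weightX lam α * weightT lam α with hS
  have hPt : ∀ x t, (x, t) ∈ U → partialT (fun z => fieldP lam (φ z)) x t =
      fieldQ lam (φ (x, t)) * S (φ (x, t)) - S (φ (x, t)) * fieldQ lam (φ (x, t)) := by
    intro x t hxt
    ext j k
    exact (hasDerivAt_field (weightX lam) (weightT lam)
      (eq_neg_of_add_eq_zero_left (field_mem_uLie (weightT lam) (φ (x, t))))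
      (ht x t hxt) j k).deriv
  have hQx : ∀ x t, (x, t) ∈ U → partialX (fun z => fieldQ lam (φ z)) x t =
      fieldP lam (φ (x, t)) * S (φ (x, t)) - S (φ (x, t)) * fieldP lam (φ (x, t)) := by
    intro x t hxt
    have hS' : S = field fun α => weightT lam α * weightX lam α := by
      simp only [hS, mul_comm]
    rw [hS']
    ext j k
    exact (hasDerivAt_field (weightT lam) (weightX lam)
      (eq_neg_of_add_eq_zero_left (field_mem_uLie (weightX lam) (φ (x, t))))
      (hx x t hxt) j k).deriv
  have hsum : ∀ p, S p = (1 / 2 : ℂ) • (fieldP lam p + fieldQ lam p) := by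
    intro p
    rw [fieldP_add_fieldQ hne, smul_smul]
    norm_num [hS]
  refine ⟨contDiffOn_field _ h.contDiffOn, contDiffOn_field _ h.contDiffOn,
    fun z _ => field_mem_uLie _ _, fun z _ => field_mem_uLie _ _, fun x t hxt => ?_,
    fun x t hxt => ?_⟩
  · rw [hPt x t hxt, hQx x t hxt, hsum]
    simp only [Matrix.mul_smul, Matrix.smul_mul, mul_add, add_mul]
    module
  · rw [hPt x t hxt, hQx x t hxt, hsum]
    simp only [Matrix.mul_smul, Matrix.smul_mul, mul_add, add_mul]
    module

/-! ### Removing the traces -/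

/-- The projection `A - (tr A / n) I` of a matrix onto the matrices of trace `0`, for `n ≠ 0`. -/
noncomputable def tracelessPart {n : ℕ} (A : Matrix (Fin n) (Fin n) ℂ) :
    Matrix (Fin n) (Fin n) ℂ :=
  A - ((1 / n : ℂ) * A.trace) • (1 : Matrix (Fin n) (Fin n) ℂ)

theorem tracelessPart_mem_suLie {n : ℕ} [NeZero n] {A : Matrix (Fin n) (Fin n) ℂ}
    (hA : A ∈ uLie n) : tracelessPart A ∈ suLie n := by
  have hA' : A.conjTranspose = -A := eq_neg_of_add_eq_zero_left hA
  have htr : star A.trace = -A.trace := by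
    rw [← Matrix.trace_conjTranspose, hA', Matrix.trace_neg]
  constructor
  · change (tracelessPart A).conjTranspose + tracelessPart A = 0
    simp only [tracelessPart, Matrix.conjTranspose_sub, Matrix.conjTranspose_smul,
      Matrix.conjTranspose_one, hA', star_mul', htr, star_div₀, star_one, star_natCast]
    module
  · have hn : (n : ℂ) ≠ 0 := Nat.cast_ne_zero.mpr (NeZero.ne n)
    simp only [tracelessPart, Matrix.trace_sub, Matrix.trace_smul, Matrix.trace_one,
      Fintype.card_fin, smul_eq_mul]
    field_simp
    ring

theorem contDiffOn_tracelessPart {n : ℕ} {U : Set (ℝ × ℝ)}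
    {A : ℝ × ℝ → Matrix (Fin n) (Fin n) ℂ} (hA : ∀ j k, ContDiffOn ℝ 1 (fun z => A z j k) U)
    (j k : Fin n) : ContDiffOn ℝ 1 (fun z => tracelessPart (A z) j k) U :=
  (hA j k).sub ((contDiffOn_const.mul (ContDiffOn.sum fun i _ => hA i i)).mul contDiffOn_const)

theorem deriv_tracelessPart {n : ℕ} {A : ℝ → Matrix (Fin n) (Fin n) ℂ} {s : ℝ}
    (hA : ∀ j k, DifferentiableAt ℝ (fun s => A s j k) s) (j k : Fin n) :
    deriv (fun s => tracelessPart (A s) j k) s =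
      tracelessPart (Matrix.of fun j k => deriv (fun s => A s j k) s) j k :=
  HasDerivAt.deriv <| (hA j k).hasDerivAt.sub
    (((HasDerivAt.fun_sum fun i _ => (hA i i).hasDerivAt).const_mul _).mul_const _)

/-- The trace of a commutator is `0`, so the equations give `tr P_t = tr Q_x = 0`: removing the traces
changes neither the derivatives nor the commutator. -/
theorem IsChiralSolution.tracelessPart {n : ℕ} [NeZero n] {U : Set (ℝ × ℝ)} (hU : IsOpen U)
    {P Q : ℝ × ℝ → Matrix (Fin n) (Fin n) ℂ} (h : IsChiralSolution (uLie n) U P Q) :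
    IsChiralSolution (suLie n) U (fun z => tracelessPart (P z)) (fun z => tracelessPart (Q z)) := by
  have hsub : ∀ x t, (x, t) ∈ U →
      partialT (fun z => ChiralField.tracelessPart (P z)) x t = partialT P x t ∧
      partialX (fun z => ChiralField.tracelessPart (Q z)) x t = partialX Q x t := by
    intro x t hxt
    have h1 := congrArg Matrix.trace (h.eq_conservation x t hxt)
    have h2 := congrArg Matrix.trace (h.eq_compatibility x t hxt)
    simp only [Matrix.trace_add, Matrix.trace_sub, Matrix.trace_zero] at h1 h2
    rw [Matrix.trace_mul_comm (P (x, t)), sub_self, add_zero] at h2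
    have hP : (partialT P x t).trace = 0 := by linear_combination (h1 + h2) / 2
    have hQ : (partialX Q x t).trace = 0 := by linear_combination (h1 - h2) / 2
    constructor
    · ext j k
      refine (deriv_tracelessPart (fun j k =>
        (differentiableAt_slices hU (h.contDiffOn_P j k) hxt).2) j k).trans ?_
      change ChiralField.tracelessPart (partialT P x t) j k = _
      simp [ChiralField.tracelessPart, hP]
    · ext j k
      refine (deriv_tracelessPart (fun j k =>
        (differentiableAt_slices hU (h.contDiffOn_Q j k) hxt).1) j k).trans ?_
      change ChiralField.tracelessPart (partialX Q x t) j k = _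
      simp [ChiralField.tracelessPart, hQ]
  refine ⟨contDiffOn_tracelessPart h.contDiffOn_P, contDiffOn_tracelessPart h.contDiffOn_Q,
    fun z hz => tracelessPart_mem_suLie (h.mem_P z hz),
    fun z hz => tracelessPart_mem_suLie (h.mem_Q z hz), fun x t hxt => ?_, fun x t hxt => ?_⟩
  · rw [(hsub x t hxt).1, (hsub x t hxt).2, h.eq_conservation x t hxt]
  · rw [(hsub x t hxt).1, (hsub x t hxt).2, ← h.eq_compatibility x t hxt]
    simp only [ChiralField.tracelessPart, mul_sub, sub_mul, Matrix.mul_smul, Matrix.smul_mul,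
      mul_one, one_mul]
    module

/-! ### The integrals -/

theorem isDividedDifference_weightX {N : ℕ} {lam : Fin N → ℝ} (hinj : Function.Injective lam)
    (hne : ∀ α, lam α ≠ 1) :
    IsDividedDifference lam fun α β => -(1 / 2) * (weightX lam α * weightX lam β) := by
  refine ⟨fun α => -(1 / 2) * weightX lam α, fun α β hαβ => ?_⟩
  have h1 : 1 - lam α ≠ 0 := sub_ne_zero.mpr (hne α).symm
  have h2 : 1 - lam β ≠ 0 := sub_ne_zero.mpr (hne β).symm
  have h3 : lam α - lam β ≠ 0 := sub_ne_zero.mpr (hinj.ne hαβ)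
  unfold weightX
  field_simp
  ring

theorem isDividedDifference_weightT {N : ℕ} {lam : Fin N → ℝ} (hinj : Function.Injective lam)
    (hne : ∀ α, lam α ≠ -1) :
    IsDividedDifference lam fun α β => -(1 / 2) * (weightT lam α * weightT lam β) := by
  refine ⟨fun α => (1 / 2) * weightT lam α, fun α β hαβ => ?_⟩
  have h1 : 1 + lam α ≠ 0 := fun h => hne α (by linarith)
  have h2 : 1 + lam β ≠ 0 := fun h => hne β (by linarith)
  have h3 : lam α - lam β ≠ 0 := sub_ne_zero.mpr (hinj.ne hαβ)
  unfold weightT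
  field_simp
  ring

/-- The coefficients `(δ_{αμ} - δ_{βμ}) / (λ_α - λ_β)` of the Gaudin Hamiltonian
`2 ∑_{β ≠ μ} |φ_μ^* φ_β|² / (λ_μ - λ_β)`.  The diagonal coefficients are `0 / 0 = 0`. -/
noncomputable def gaudinCoeff {N : ℕ} (lam : Fin N → ℝ) (μ α β : Fin N) : ℝ :=
  ((Pi.single μ 1 : Fin N → ℝ) α - (Pi.single μ 1 : Fin N → ℝ) β) / (lam α - lam β)

theorem gaudinCoeff_symm {N : ℕ} (lam : Fin N → ℝ) (μ α β : Fin N) :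
    gaudinCoeff lam μ α β = gaudinCoeff lam μ β α := by
  unfold gaudinCoeff
  rw [← neg_sub, ← neg_sub (lam β), neg_div_neg_eq]

theorem isDividedDifference_gaudinCoeff {N : ℕ} (lam : Fin N → ℝ) (μ : Fin N) :
    IsDividedDifference lam (gaudinCoeff lam μ) :=
  ⟨Pi.single μ 1, fun _ _ _ => rfl⟩

/-- The `2N` integrals: `inl μ` stands for `|φ_μ|²`, `inr o` for `∑_α |φ_{1α}|²`
(the component with index `0` in `Fin 2`), and `inr μ` with `μ ≠ o` for the Gaudin Hamiltonian of the site `μ`. -/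
noncomputable def gaudinIntegral {N : ℕ} (lam : Fin N → ℝ) (o : Fin N) :
    Fin N ⊕ Fin N → Phase 2 N → ℝ
  | .inl μ => quadratic fun _ => Pi.single μ 1
  | .inr μ => if μ = o then quadratic fun j _ => (Pi.single 0 1 : Fin 2 → ℝ) j
      else quartic (gaudinCoeff lam μ)

theorem contDiff_gaudinIntegral {N : ℕ} (lam : Fin N → ℝ) (o : Fin N) (i : Fin N ⊕ Fin N) :
    ContDiff ℝ ω (gaudinIntegral lam o i) := by
  rcases i with μ | μ
  · exact contDiff_quadratic _
  · simp only [gaudinIntegral]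
    split_ifs
    · exact contDiff_quadratic _
    · exact contDiff_quartic _

theorem poisson_gaudinIntegral_quartic {N : ℕ} {lam : Fin N → ℝ} (hinj : Function.Injective lam)
    (o : Fin N) {c : Fin N → Fin N → ℝ} (hc : ∀ α β, c α β = c β α)
    (hc' : IsDividedDifference lam c) (i : Fin N ⊕ Fin N) (p : Phase 2 N) :
    poisson (gaudinIntegral lam o i) (quartic c) p = 0 := by
  rcases i with μ | μ
  · exact poisson_siteQuadratic_quartic _ hc p
  · simp only [gaudinIntegral]
    split_ifs
    · exact poisson_componentQuadratic_quartic _ hc p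
    · exact poisson_quartic_quartic hinj (gaudinCoeff_symm lam μ) hc
        (isDividedDifference_gaudinCoeff lam μ) hc' p

theorem poisson_gaudinIntegral_gaudinIntegral {N : ℕ} {lam : Fin N → ℝ}
    (hinj : Function.Injective lam) (o : Fin N) (i k : Fin N ⊕ Fin N) (p : Phase 2 N) :
    poisson (gaudinIntegral lam o i) (gaudinIntegral lam o k) p = 0 := by
  -- an integral is quadratic, or it is a Gaudin Hamiltonian
  have key : ∀ i, (∃ h, gaudinIntegral lam o i = quadratic h) ∨
      ∃ μ, gaudinIntegral lam o i = quartic (gaudinCoeff lam μ) := by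
    rintro (μ | μ)
    · exact Or.inl ⟨_, rfl⟩
    · by_cases h : μ = o
      · exact Or.inl ⟨_, if_pos h⟩
      · exact Or.inr ⟨μ, if_neg h⟩
  have hquartic : ∀ i μ, poisson (gaudinIntegral lam o i) (quartic (gaudinCoeff lam μ)) p = 0 :=
    fun i μ => poisson_gaudinIntegral_quartic hinj o (gaudinCoeff_symm lam μ)
      (isDividedDifference_gaudinCoeff lam μ) i p
  obtain ⟨h, hk⟩ | ⟨μ, hk⟩ := key k
  · obtain ⟨h', hi⟩ | ⟨μ, hi⟩ := key i
    · rw [hi, hk, poisson_quadratic_quadratic]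
    · rw [poisson_swap, hi, hquartic, neg_zero]
  · rw [hk, hquartic]

/-! ### Independence of the integrals at one point -/

/-- The point with `φ_o = (1, 1)` and `φ_α = (1, 0)` for `α ≠ o`. -/
noncomputable def basePoint {N : ℕ} (o : Fin N) : Phase 2 N :=
  fun j α => if α = o then 1 else (Pi.single 0 1 : Fin 2 → ℂ) j

/-- The phase space vector whose `β`-th site is `a ∈ ℂⁿ` and whose other sites are `0`. -/
def column {n N : ℕ} (β : Fin N) (a : Fin n → ℂ) : Phase n N :=
  fun j => Pi.single β (a j)

theorem HasGradient.fderiv_column {n N : ℕ} {f : Phase n N → ℝ} {g p : Phase n N}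
    (h : HasGradient f g p) (β : Fin N) (a : Fin n → ℂ) :
    fderiv ℝ f p (column β a) = 2 * ∑ j, (starRingEnd ℂ (g j β) * a j).re := by
  rw [h]
  congr 1
  refine Finset.sum_congr rfl fun j _ => ?_
  rw [Finset.sum_eq_single β]
  · simp [column]
  · intro α _ hα; simp [column, hα]
  · simp

/-- Tangent vectors at `basePoint o` moving a single site `β`: `inl β` is radial, `inr β` is orthogonal
to `φ_β` in `ℂ²`. -/
noncomputable def testVector {N : ℕ} (o : Fin N) : Fin N ⊕ Fin N → Phase 2 N
  | .inl β => column β fun j => basePoint o j β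
  | .inr β => column β (if β = o then ![1, -1] else ![0, 1])

/-- Moving `φ_β = (1, 0)` in the direction `(0, 1)` changes, to first order, only `|φ_β^* φ_o|²`. -/
theorem fderiv_gaudin_testVector {N : ℕ} (lam : Fin N → ℝ) {o μ β : Fin N} (hμ : μ ≠ o)
    (hβ : β ≠ o) :
    fderiv ℝ (quartic (gaudinCoeff lam μ)) (basePoint o) (testVector o (.inr β)) =
      if β = μ then 4 / (lam μ - lam o) else 0 := by
  rw [testVector, (hasGradient_quartic (gaudinCoeff_symm lam μ) _).fderiv_column,
    Fin.sum_univ_two]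
  have h : ∑ α, (gaudinCoeff lam μ β α : ℂ) * gram (basePoint o) α β * basePoint o 1 α =
      gaudinCoeff lam μ β o := by
    rw [Finset.sum_eq_single o]
    · simp [gram, basePoint, hβ]
    · intro α _ hα; simp [basePoint, hα]
    · simp
  rw [h]
  by_cases hβμ : β = μ
  · subst hβμ
    simp only [if_neg hβ, Matrix.cons_val_zero, Matrix.cons_val_one, map_mul,
      Complex.conj_ofReal, mul_zero, Complex.zero_re, zero_add, mul_one, ← Complex.ofReal_ofNat,
      ← Complex.ofReal_mul, Complex.ofReal_re, if_pos]
    simp only [gaudinCoeff, Pi.single_eq_same, Pi.single_eq_of_ne hβ.symm]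
    ring
  · simp [gaudinCoeff, hβ, Pi.single_apply, hβμ, hμ.symm]

/-- The Jacobian is block triangular: the vectors `inr β` see none of the norms, and among them those
with `β ≠ o` see only the Gaudin Hamiltonian of the site `β`. -/
theorem linearIndependent_gaudinIntegral_basePoint {N : ℕ} {lam : Fin N → ℝ}
    (hinj : Function.Injective lam) (o : Fin N) :
    LinearIndependent ℝ fun i k => fderiv ℝ (gaudinIntegral lam o i) (basePoint o) (testVector o k) := by
  rw [Fintype.linearIndependent_iff]
  intro g hg
  have hk : ∀ k, ∑ μ, g (.inl μ) *
        fderiv ℝ (gaudinIntegral lam o (.inl μ)) (basePoint o) (testVector o k) +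
      ∑ μ, g (.inr μ) *
        fderiv ℝ (gaudinIntegral lam o (.inr μ)) (basePoint o) (testVector o k) = 0 := by
    intro k
    have := congrFun hg k
    simpa only [Finset.sum_apply, Pi.smul_apply, smul_eq_mul, Fintype.sum_sum_type,
      Pi.zero_apply] using this
  -- the test vector `inr β` is tangent to the level sets of all the norms `|φ_μ|²`
  have hlr : ∀ μ β, fderiv ℝ (gaudinIntegral lam o (.inl μ)) (basePoint o)
      (testVector o (.inr β)) = 0 := by
    intro μ β
    rw [gaudinIntegral, testVector, (hasGradient_quadratic _ _).fderiv_column, Fin.sum_univ_two]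
    by_cases hβ : β = o <;> simp [basePoint, hβ]
  have hrr : ∀ β, β ≠ o →
      fderiv ℝ (gaudinIntegral lam o (.inr o)) (basePoint o) (testVector o (.inr β)) = 0 := by
    intro β hβ
    rw [gaudinIntegral, if_pos rfl, testVector, (hasGradient_quadratic _ _).fderiv_column,
      Fin.sum_univ_two]
    simp [basePoint, hβ]
  have hoo : fderiv ℝ (gaudinIntegral lam o (.inr o)) (basePoint o) (testVector o (.inr o)) = 2 := by
    rw [gaudinIntegral, if_pos rfl, testVector, (hasGradient_quadratic _ _).fderiv_column,
      Fin.sum_univ_two]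
    simp [basePoint]
  have h1 : ∀ β, β ≠ o → g (.inr β) = 0 := by
    intro β hβ
    have h := hk (.inr β)
    simp only [hlr, mul_zero, Finset.sum_const_zero, zero_add] at h
    rw [Finset.sum_eq_single β] at h
    · rw [gaudinIntegral, if_neg hβ, fderiv_gaudin_testVector lam hβ hβ, if_pos rfl] at h
      have hne : lam β - lam o ≠ 0 := sub_ne_zero.mpr (hinj.ne hβ)
      exact (mul_eq_zero.mp h).resolve_right (div_ne_zero four_ne_zero hne)
    · intro μ _ hμβ
      by_cases hμ : μ = o
      · rw [hμ, hrr β hβ, mul_zero]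
      · rw [gaudinIntegral, if_neg hμ, fderiv_gaudin_testVector lam hμ hβ, if_neg hμβ.symm, mul_zero]
    · simp
  have h2 : ∀ β, g (.inr β) = 0 := by
    intro β
    by_cases hβ : β = o
    · subst hβ
      have h := hk (.inr β)
      simp only [hlr, mul_zero, Finset.sum_const_zero, zero_add] at h
      rw [Finset.sum_eq_single β, hoo] at h
      · linarith
      · intro μ _ hμ; rw [h1 μ hμ, zero_mul]
      · simp
    · exact h1 β hβ
  rintro (β | β)
  · have h := hk (.inl β)
    simp only [h2, zero_mul, Finset.sum_const_zero, add_zero] at h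
    rw [Finset.sum_eq_single β] at h
    · refine (mul_eq_zero.mp h).resolve_right ?_
      rw [gaudinIntegral, testVector, (hasGradient_quadratic _ _).fderiv_column, Fin.sum_univ_two]
      by_cases hβ : β = o <;> simp [basePoint, hβ]
    · intro μ _ hμ
      rw [gaudinIntegral, testVector, (hasGradient_quadratic _ _).fderiv_column, Fin.sum_univ_two]
      simp [hμ.symm]
    · simp
  · exact h2 β

/-- One set of integrals serves all quartic functions of divided difference type simultaneously. -/
theorem exists_isLiouvilleIntegrals {N : ℕ} {lam : Fin N → ℝ} (hinj : Function.Injective lam) :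
    ∃ F : Fin (2 * N) → Phase 2 N → ℝ, ∀ c : Fin N → Fin N → ℝ, (∀ α β, c α β = c β α) →
      IsDividedDifference lam c → IsLiouvilleIntegrals (quartic c) F := by
  rcases isEmpty_or_nonempty (Fin N) with hN | ⟨⟨o⟩⟩
  · have : IsEmpty (Fin (2 * N)) := by
      refine ⟨fun i => hN.elim ((finProdFinEquiv (m := 2) (n := N)).symm i).2⟩
    exact ⟨isEmptyElim, fun c _ _ => ⟨isEmptyElim, isEmptyElim, isEmptyElim,
      Set.univ, isOpen_univ, dense_univ, fun p _ => linearIndependent_empty_type⟩⟩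
  · let e : Fin (2 * N) ≃ Fin N ⊕ Fin N := (finCongr (two_mul N)).trans finSumFinEquiv.symm
    obtain ⟨V, hV, hV', hli⟩ := exists_dense_linearIndependent_fderiv (contDiff_gaudinIntegral lam o)
      (basePoint o) (testVector o) (linearIndependent_gaudinIntegral_basePoint hinj o)
    exact ⟨fun i => gaudinIntegral lam o (e i), fun c hc hc' =>
      ⟨fun i => contDiff_gaudinIntegral lam o (e i),
        fun i p => poisson_gaudinIntegral_quartic hinj o hc hc' (e i) p,
        fun i k p => poisson_gaudinIntegral_gaudinIntegral hinj o (e i) (e k) p,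
        V, hV, hV', fun p hp => (hli p hp).comp e e.injective⟩⟩

end ChiralField

theorem mainTheorem2 (N : ℕ) (lam : Fin N → ℝ) (hinj : Function.Injective lam)
    (hne : ∀ α, lam α ≠ 1 ∧ lam α ≠ -1) :
    (∃ F : Fin (2 * N) → ChiralField.Phase 2 N → ℝ,
      ChiralField.IsLiouvilleIntegrals (ChiralField.Hx 2 lam) F ∧
      ChiralField.IsLiouvilleIntegrals (ChiralField.Ht 2 lam) F) ∧
    ∀ (U : Set (ℝ × ℝ)) (φ : ℝ × ℝ → ChiralField.Phase 2 N), IsOpen U →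
      ChiralField.IsHamiltonianSolution lam U φ →
        ChiralField.IsChiralSolution (ChiralField.uLie 2) U
          (fun z => ChiralField.fieldP lam (φ z)) (fun z => ChiralField.fieldQ lam (φ z)) ∧
        ChiralField.IsChiralSolution (ChiralField.suLie 2) U
          (fun z => ChiralField.fieldP lam (φ z)
            - ((1 / 2 : ℂ) * (ChiralField.fieldP lam (φ z)).trace) •
              (1 : Matrix (Fin 2) (Fin 2) ℂ))
          (fun z => ChiralField.fieldQ lam (φ z)
            - ((1 / 2 : ℂ) * (ChiralField.fieldQ lam (φ z)).trace) •
              (1 : Matrix (Fin 2) (Fin 2) ℂ)) := by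
  constructor
  · obtain ⟨F, hF⟩ := ChiralField.exists_isLiouvilleIntegrals hinj
    refine ⟨F, ?_, ?_⟩
    · rw [ChiralField.Hx, ChiralField.hamiltonian_eq_quartic]
      exact hF _ (fun α β => by ring)
        (ChiralField.isDividedDifference_weightX hinj fun α => (hne α).1)
    · rw [ChiralField.Ht, ChiralField.hamiltonian_eq_quartic]
      exact hF _ (fun α β => by ring)
        (ChiralField.isDividedDifference_weightT hinj fun α => (hne α).2)
  · intro U φ hU hφ
    have h := hφ.isChiralSolution hne hU
    exact ⟨h, h.tracelessPart hU⟩
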